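/- Let $n\ge 0$, let $S^{2n+1}\subset\mathbb{C}^{n+1}$ be the unit sphere with coordinate functions $z_1,\dots,z_{n+1}$, and let $\zeta_0=z_0,\ \zeta_j=z_0z_j$ $(1\le j\le n+1)$ be homogeneous coordinates on $\mathbb{C}^{n+2}$, with null cone $\mathcal N=\{\zeta\neq0:\ |\zeta_0|^2=\sum_{j=1}^{n+1}|\zeta_j|^2\}$ and Laplacian $$\boldsymbol\Delta=-2\Big(-\frac{\partial^2}{\partial\zeta_0\partial\bar\zeta_0}+\sum_{j=1}^{n+1}\frac{\partial^2}{\partial\zeta_j\partial\bar\zeta_j}\Big)$$ of the flat Lorentz–Kähler ambient metric. For $w,w'\in\mathbb{C}$ such that $k=w+w'+n+1$ is a nonnegative integer and $f\in C^\infty(S^{2n+1};\mathbb{C})$, define $$P_{w,w'}f=z_0^{\,k-w}\,\bar z_0^{\,k-w'}\;2^{-k}\,(\boldsymbol\Delta^k\boldsymbol F)\big|_{\mathcal N},$$ where $\boldsymbol F$ is any smooth function, defined locally near points of $\mathcal N$, that is homogeneous of bidegree $(w,w')$, i.e. $\sum_{i=0}^{n+1}\zeta_i\,\partial\boldsymbol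 F/\partial\zeta_i=w\boldsymbol F$ and $\sum_{i=0}^{n+1}\bar\zeta_i\,\partial\boldsymbol F/\partial\bar\zeta_i=w'\boldsymbol F$, and satisfies $\boldsymbol F|_{\mathcal N}=z_0^{w}\bar z_0^{w'}f$. (The result is independent of the choice of $\boldsymbol F$ and of bidegree $(0,0)$, hence a function on $S^{2n+1}$; if $w-w'\notin\mathbb{Z}$, the powers of $z_0$ are taken with the branch equal to $1$ at $z_0=1$, and the result is evaluated at $z_0=1$. For $k=0$, $P_{w,w'}$ is the identity.) Suppose that $k=w+w'+n+1$ is a positive integer. Then, as operators on $C^\infty(S^{2n+1};\mathbb{C})$, $$\sum_{j=1}^{n+1}\bar z_j\,[P_{w,w'},z_j]=-k\,(w'-k+1)\,P_{w-1,w'},$$ where $[P,z_j]u=P(z_ju)-z_jP(u)$. -/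

import Mathlib

open scoped Manifold ContDiff ComplexConjugate Topology

noncomputable section

namespace CRSphere

/-- The unit sphere `S^{2n+1}` in `ℂ^{n+1}`, with the standard smooth structure of Mathlib. -/
abbrev Sph (n : ℕ) : Type :=
  Metric.sphere (0 : EuclideanSpace ℂ (Fin (n + 1))) 1

instance factFinrank (n : ℕ) :
    Fact (Module.finrank ℝ (EuclideanSpace ℂ (Fin (n + 1))) = 2 * n + 1 + 1) :=
  ⟨by
    rw [← Module.finrank_mul_finrank ℝ ℂ (EuclideanSpace ℂ (Fin (n + 1))),
      Complex.finrank_real_complex, finrank_euclideanSpace_fin]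
    ring⟩

/-- `u ∈ C^∞(S^{2n+1}; ℂ)`. -/
def SmoothOnSphere (n : ℕ) (u : Sph n → ℂ) : Prop :=
  ContMDiff (𝓡 (2 * n + 1)) 𝓘(ℝ, ℂ) ∞ u

/-- The coordinate function `z_j` on the sphere (indices start from `0`). -/
def coord {n : ℕ} (j : Fin (n + 1)) (z : Sph n) : ℂ :=
  (z : EuclideanSpace ℂ (Fin (n + 1))) j

/-- The ambient space `ℂ^{n+2}` with coordinates `ζ_0, …, ζ_{n+1}`. -/
abbrev Amb (n : ℕ) : Type := Fin (n + 2) → ℂ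

/-- Wirtinger derivative `∂F/∂ζ_i`. -/
def dζ {n : ℕ} (i : Fin (n + 2)) (F : Amb n → ℂ) (ζ : Amb n) : ℂ :=
  (1 / 2) * (fderiv ℝ F ζ (Pi.single i 1) - Complex.I * fderiv ℝ F ζ (Pi.single i Complex.I))

/-- Wirtinger derivative `∂F/∂ζ̄_i`. -/
def dζbar {n : ℕ} (i : Fin (n + 2)) (F : Amb n → ℂ) (ζ : Amb n) : ℂ :=
  (1 / 2) * (fderiv ℝ F ζ (Pi.single i 1) + Complex.I * fderiv ℝ F ζ (Pi.single i Complex.I))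

/-- The holomorphic Euler field `Z = ∑ ζ_i ∂/∂ζ_i`. -/
def eulerZ {n : ℕ} (F : Amb n → ℂ) (ζ : Amb n) : ℂ :=
  ∑ i, ζ i * dζ i F ζ

/-- The antiholomorphic Euler field `Z̄ = ∑ ζ̄_i ∂/∂ζ̄_i`. -/
def eulerZbar {n : ℕ} (F : Amb n → ℂ) (ζ : Amb n) : ℂ :=
  ∑ i, conj (ζ i) * dζbar i F ζ

/-- The Laplacian (with the sign convention `-∇^a ∇_a`) `Δ = -2 (-∂_0 ∂_{0̄} + ∑_{j ≥ 1} ∂_j ∂_{j̄})` of the flat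
Lorentz-Kähler metric `i (-dζ_0 ∧ dζ̄_0 + ∑_{j ≥ 1} dζ_j ∧ dζ̄_j)`. -/
def ambLaplacian {n : ℕ} (F : Amb n → ℂ) (ζ : Amb n) : ℂ :=
  -2 * (-(dζ 0 (dζbar 0 F) ζ) + ∑ j : Fin (n + 1), dζ j.succ (dζbar j.succ F) ζ)

/-- The homogeneous coordinates `ζ_0 = z_0`, `ζ_j = z_0 z_j`. For `z_0 ≠ 0` and `z` in the sphere
these are exactly the points of the null cone `|ζ_0|² = ∑_{j ≥ 1} |ζ_j|²`, `ζ ≠ 0`. -/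
def homCoord {n : ℕ} (z₀ : ℂ) (z : Sph n) : Amb n :=
  Fin.cons z₀ fun j => z₀ * coord j z

/-- `z_0^v z̄_0^{v'}` for `z_0 ≠ 0`. It does not depend on the branch of the logarithm when
`v - v' ∈ ℤ`; otherwise it is the branch which is smooth near `z_0 = 1`, with value `1` there. -/
def bipow (v v' : ℂ) (z₀ : ℂ) : ℂ :=
  Complex.exp (v * Complex.log z₀ + v' * conj (Complex.log z₀))

/-- `F` is a smooth function near `ζ`, homogeneous of bidegree `(w, w')`, i.e. a germ at `ζ` of the
sheaf of homogeneous functions on the ambient space. -/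
def IsHomogeneousNear {n : ℕ} (w w' : ℂ) (F : Amb n → ℂ) (ζ : Amb n) : Prop :=
  ∀ᶠ η in 𝓝 ζ, ContDiffAt ℝ ∞ F η ∧ eulerZ F η = w * F η ∧ eulerZbar F η = w' * F η

/-- Near the point of the null cone over `z` with `z_0 = 1`, `F` is a smooth homogeneous function of
bidegree `(w, w')` whose restriction to the null cone is `z_0^w z̄_0^{w'} f`. -/
def IsAmbientExtension {n : ℕ} (w w' : ℂ) (f : Sph n → ℂ) (z : Sph n) (F : Amb n → ℂ) : Prop :=
  IsHomogeneousNear w w' F (homCoord 1 z) ∧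
    ∀ᶠ p : ℂ × Sph n in 𝓝 (1, z), F (homCoord p.1 p.2) = bipow w w' p.1 * f p.2

open Classical in
/-- The operator `P_{w,w'}` of order `2k`, `k = w + w' + n + 1`: extend `z_0^w z̄_0^{w'} f` from the
null cone to an (arbitrarily chosen) homogeneous function `F`, restrict `2^{-k} Δ^k F` to the null
cone and multiply by `z_0^{k-w} z̄_0^{k-w'}`. The result has bidegree `(0, 0)`, so as a function on the
sphere it is its value at `z_0 = 1`. The choice of `F` is immaterial for `k = w + w' + n + 1`. -/
def gjms (n k : ℕ) (w w' : ℂ) (f : Sph n → ℂ) (z : Sph n) : ℂ :=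
  if h : ∃ F : Amb n → ℂ, IsAmbientExtension w w' f z F then
    bipow (k - w) (k - w') 1 *
      ((1 / 2 : ℂ) ^ k * (ambLaplacian^[k] h.choose) (homCoord 1 z))
  else 0

/-- The commutator `[P, φ] u = P (φ u) - φ P u` with the multiplication operator by `φ`. -/
def commMul {n : ℕ} (P : (Sph n → ℂ) → Sph n → ℂ) (φ : Sph n → ℂ) (u : Sph n → ℂ) (z : Sph n) : ℂ :=
  P (fun y => φ y * u y) z - φ z * P u z

end CRSphere

end

/-! Write `r` for `coneFn` and `ε_i` for the signature. Choose one extension `G` of `u` of bidegree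
`(w - 1, w')`. Then `ζ_0 G` extends `u` and `ζ_j G` extends `z_j u`, both in bidegree `(w, w')`, so
both halves of every commutator are computed from the same `G`.

Since `ζ_i` is holomorphic, `[Δ, ζ_i] = -2 ε_i ∂/∂ζ̄_i` has constant coefficients and commutes with
`Δ`; hence `[Δ^k, ζ_i] = -2k ε_i (∂/∂ζ̄_i) Δ^(k-1)` (`ambLaplacian_iterate_ambCoord_mul`). At `ζ =
(1, z)` the terms with `Δ^k G` cancel, and `ε_0 = -1` leaves `-2k (∂/∂ζ̄_j + z_j ∂/∂ζ̄_0) Δ^(k-1)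
G`. Multiplying by `z̄_j` and summing over the unit sphere yields the antiholomorphic Euler field,
which acts on `Δ^(k-1) G` by the scalar `w' - k + 1` (`euler_ambLaplacian_iterate`).

As `gjms` picks an extension by choice, two further facts are needed. Extensions exist
(`exists_isAmbientExtension`), and `Δ^k F` on the cone does not depend on the one chosen
(`ambLaplacian_iterate_eq_of_extension`): the difference of two extensions is `r` times a smooth
function (`exists_eq_coneFn_mul`), and the scalar in `[Δ^k, r]` vanishes in the critical weight
(`ambLaplacian_iterate_coneFn_mul`). -/

namespace CRSphere

/-! ### Hadamard's lemma with smooth parameters -/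

/-- The integral of a `C^m` function over a compact interval of parameters is `C^m`. -/
theorem contDiff_parametric_integral_nat {E F : Type} [NormedAddCommGroup E] [NormedSpace ℝ E]
    [FiniteDimensional ℝ E] [NormedAddCommGroup F] [NormedSpace ℝ F] [CompleteSpace F] (m : ℕ)
    {f : E × ℝ → F} (hf : ContDiff ℝ m f) :
    ContDiff ℝ m fun x => ∫ s in (0 : ℝ)..1, f (x, s) := by
  -- The derivative is an integral of the same kind with values in `E →L[ℝ] F`, so the target must
  -- vary; with both spaces in `Type` it stays in the same universe.
  induction m generalizing F with
  | zero =>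
    rw [Nat.cast_zero, contDiff_zero] at hf ⊢
    exact intervalIntegral.continuous_parametric_intervalIntegral_of_continuous'
      (f := fun x s => f (x, s)) hf 0 1
  | succ m ih =>
    have hf' : ContDiff ℝ m fun q : E × ℝ =>
        (fderiv ℝ f q).comp (ContinuousLinearMap.inl ℝ E ℝ) :=
      (hf.fderiv_right (by norm_cast)).clm_comp contDiff_const
    have hfc : Continuous f := hf.continuous
    have hd : Differentiable ℝ f := hf.differentiable (by simp)
    push_cast
    rw [contDiff_succ_iff_hasFDerivAt]
    refine ⟨_, ih hf', fun x => ?_⟩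
    obtain ⟨C, hC⟩ := ((isCompact_closedBall x (1 : ℝ)).prod
      (isCompact_Icc (a := (0 : ℝ)) (b := 1))).exists_bound_of_continuousOn
        hf'.continuous.continuousOn
    refine intervalIntegral.hasFDerivAt_integral_of_dominated_of_fderiv_le
      (F := fun y s => f (y, s))
      (F' := fun y s => (fderiv ℝ f (y, s)).comp (ContinuousLinearMap.inl ℝ E ℝ))
      (bound := fun _ => C) (Metric.closedBall_mem_nhds x one_pos) ?_ ?_ ?_ ?_ ?_ ?_
    · exact Filter.Eventually.of_forall fun y =>
        (hfc.comp (Continuous.prodMk_right y)).aestronglyMeasurable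
    · exact (hfc.comp (Continuous.prodMk_right x)).intervalIntegrable _ _
    · exact (hf'.continuous.comp (Continuous.prodMk_right x)).aestronglyMeasurable
    · refine Filter.Eventually.of_forall fun s hs y hy => hC (y, s) ⟨hy, ?_⟩
      rw [Set.uIoc_of_le zero_le_one] at hs
      exact ⟨hs.1.le, hs.2⟩
    · exact intervalIntegrable_const
    · exact Filter.Eventually.of_forall fun s _ y _ =>
        (hd (y, s)).hasFDerivAt.comp y (hasFDerivAt_prodMk_left y s)

theorem contDiff_parametric_integral {E F : Type} [NormedAddCommGroup E] [NormedSpace ℝ E]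
    [FiniteDimensional ℝ E] [NormedAddCommGroup F] [NormedSpace ℝ F] [CompleteSpace F]
    {f : E × ℝ → F} (hf : ContDiff ℝ ∞ f) :
    ContDiff ℝ ∞ fun x => ∫ s in (0 : ℝ)..1, f (x, s) :=
  contDiff_infty.2 fun m => contDiff_parametric_integral_nat m (contDiff_infty.1 hf m)

/-- Hadamard's lemma: a smooth function vanishing on `t = 0` is `t` times a smooth function. -/
theorem exists_smooth_quotient {E F : Type} [NormedAddCommGroup E] [NormedSpace ℝ E]
    [FiniteDimensional ℝ E] [NormedAddCommGroup F] [NormedSpace ℝ F] [CompleteSpace F]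
    {f : E × ℝ → F} (hf : ContDiff ℝ ∞ f) (h0 : ∀ x, f (x, 0) = 0) :
    ∃ g : E × ℝ → F, ContDiff ℝ ∞ g ∧ ∀ x t, f (x, t) = t • g (x, t) := by
  have hf' : ContDiff ℝ ∞ (fderiv ℝ f) := hf.fderiv_right (by simp)
  refine ⟨fun q => ∫ s in (0 : ℝ)..1, fderiv ℝ f (q.1, s * q.2) (0, 1), ?_, fun x t => ?_⟩
  · refine contDiff_parametric_integral
      (f := fun q : (E × ℝ) × ℝ => fderiv ℝ f (q.1.1, q.2 * q.1.2) (0, 1)) ?_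
    refine (hf'.comp ?_).clm_apply contDiff_const
    fun_prop
  · have hd : ∀ s : ℝ, HasDerivAt (fun s : ℝ => f (x, s * t))
        (t • fderiv ℝ f (x, s * t) (0, 1)) s := fun s => by
      have h1 : HasDerivAt (fun s : ℝ => (x, s * t)) ((0 : E), t) s := by
        simpa using (hasDerivAt_const s x).prodMk ((hasDerivAt_id s).mul_const t)
      have h2 := ((hf.differentiable (by simp)) (x, s * t)).hasFDerivAt.comp_hasDerivAt s h1
      rw [← map_smul]
      simpa [Function.comp_def] using h2
    have hint := intervalIntegral.integral_eq_sub_of_hasDerivAt (a := 0) (b := 1)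
      (fun s _ => hd s) (Continuous.intervalIntegrable (by
        have := hf'.continuous
        fun_prop) _ _)
    rw [intervalIntegral.integral_smul] at hint
    simpa [h0] using hint.symm

/-- Local form of Hadamard's lemma. -/
theorem exists_smooth_quotient_near {E F : Type} [NormedAddCommGroup E] [NormedSpace ℝ E]
    [FiniteDimensional ℝ E] [NormedAddCommGroup F] [NormedSpace ℝ F] [CompleteSpace F]
    {f : E × ℝ → F} {q : E × ℝ} (hf : ∀ᶠ y in 𝓝 q, ContDiffAt ℝ ∞ f y)
    (h0 : ∀ᶠ y in 𝓝 q, y.2 = 0 → f y = 0) :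
    ∃ g : E × ℝ → F, ContDiff ℝ ∞ g ∧ ∀ᶠ y in 𝓝 q, f y = y.2 • g y := by
  obtain ⟨U, hU, hUo, hqU⟩ := eventually_nhds_iff.1 (hf.and h0)
  obtain ⟨ε, hε, hεU⟩ := Metric.mem_nhds_iff.1 (hUo.mem_nhds hqU)
  -- A cutoff supported in `U` makes the function globally smooth without changing it near `q`.
  let χ : ContDiffBump q := ⟨ε / 4, ε / 2, by positivity, by linarith⟩
  have hχU : tsupport χ ⊆ U := by
    rw [χ.tsupport_eq]
    exact (Metric.closedBall_subset_ball (half_lt_self hε)).trans hεU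
  have hsm : ContDiff ℝ ∞ fun y => χ y • f y := contDiff_iff_contDiffAt.2 fun y => by
    by_cases hy : y ∈ tsupport χ
    · exact χ.contDiffAt.smul (hU y (hχU hy)).1
    · refine (contDiffAt_const (c := (0 : F))).congr_of_eventuallyEq ?_
      filter_upwards [notMem_tsupport_iff_eventuallyEq.1 hy] with x hx
      simp [hx]
  obtain ⟨g, hg, hfg⟩ := exists_smooth_quotient hsm fun x => by
    by_cases hx : (x, (0 : ℝ)) ∈ tsupport χ
    · rw [(hU _ (hχU hx)).2 rfl, smul_zero]
    · rw [image_eq_zero_of_notMem_tsupport hx, zero_smul]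
  refine ⟨g, hg, ?_⟩
  filter_upwards [χ.eventuallyEq_one] with y hy
  simpa [hy] using hfg y.1 y.2

end CRSphere

/-! ### Wirtinger derivatives, Euler fields and the Laplacian in uniform notation -/

namespace CRSphere

variable {n : ℕ} {U : Set (Amb n)} {F G : Amb n → ℂ}

/-- Both Wirtinger derivatives at once: `∂/∂ζ_i` for `c = -1` and `∂/∂ζ̄_i` for `c = 1`. -/
noncomputable def wirtinger (c : ℂ) (i : Fin (n + 2)) (F : Amb n → ℂ) (ζ : Amb n) : ℂ :=
  (1 / 2) * (fderiv ℝ F ζ (Pi.single i 1) + c * Complex.I * fderiv ℝ F ζ (Pi.single i Complex.I))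

/-- The coordinate `ζ_i` for `c = 1` and its conjugate for `c = -1`. -/
noncomputable def ambCoord (c : ℂ) (i : Fin (n + 2)) (ζ : Amb n) : ℂ :=
  (ζ i).re + c * Complex.I * (ζ i).im

/-- The Euler fields: `Z` for `c = -1` and `Z̄` for `c = 1`. -/
noncomputable def euler (c : ℂ) (F : Amb n → ℂ) (ζ : Amb n) : ℂ :=
  ∑ i, ambCoord (-c) i ζ * wirtinger c i F ζ

/-- The signature `(-1, 1, …, 1)` of the ambient metric. -/
def signature : Fin (n + 2) → ℂ := Fin.cons (-1) fun _ => 1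

/-- The defining function `-|ζ_0|² + ∑ |ζ_j|²` of the null cone. -/
noncomputable def coneFn (ζ : Amb n) : ℂ :=
  ∑ i, signature i * (ambCoord 1 i ζ * ambCoord (-1) i ζ)

theorem dζ_eq (i : Fin (n + 2)) : dζ (n := n) i = wirtinger (-1) i := by
  funext F ζ; simp only [dζ, wirtinger]; ring

theorem dζbar_eq (i : Fin (n + 2)) : dζbar (n := n) i = wirtinger 1 i := by
  funext F ζ; simp only [dζbar, wirtinger]; ring

theorem ambCoord_one (i : Fin (n + 2)) (ζ : Amb n) : ambCoord 1 i ζ = ζ i := by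
  apply Complex.ext <;> simp [ambCoord]

theorem ambCoord_neg_one (i : Fin (n + 2)) (ζ : Amb n) : ambCoord (-1) i ζ = conj (ζ i) := by
  apply Complex.ext <;> simp [ambCoord]

theorem eulerZ_eq : eulerZ (n := n) = euler (-1) := by
  funext F ζ; simp only [eulerZ, euler, dζ_eq, neg_neg, ambCoord_one]

theorem eulerZbar_eq : eulerZbar (n := n) = euler 1 := by
  funext F ζ; simp only [eulerZbar, euler, dζbar_eq, ambCoord_neg_one]

theorem ambLaplacian_eq (F : Amb n → ℂ) (ζ : Amb n) :
    ambLaplacian F ζ = ∑ i, -2 * signature i * wirtinger (-1) i (wirtinger 1 i F) ζ := by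
  rw [Fin.sum_univ_succ]
  simp only [ambLaplacian, dζ_eq, dζbar_eq, signature, Fin.cons_zero, Fin.cons_succ, mul_add,
    Finset.mul_sum]
  ring_nf

theorem signature_mul_self (i : Fin (n + 2)) : signature i * signature i = 1 := by
  refine Fin.cases ?_ (fun j => ?_) i <;> simp [signature]

theorem coneFn_eq (ζ : Amb n) :
    coneFn ζ = ((-‖ζ 0‖ ^ 2 + ∑ j : Fin (n + 1), ‖ζ j.succ‖ ^ 2 : ℝ) : ℂ) := by
  simp [coneFn, Fin.sum_univ_succ, signature, ambCoord_one, ambCoord_neg_one, Complex.mul_conj,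
    Complex.normSq_eq_norm_sq]

/-! ### Wirtinger calculus on smooth functions -/

theorem contDiff_ambCoord (c : ℂ) (i : Fin (n + 2)) : ContDiff ℝ ∞ (ambCoord (n := n) c i) := by
  have h1 : ContDiff ℝ ∞ fun ζ : Amb n => ((ζ i).re : ℂ) :=
    (Complex.ofRealCLM.comp (Complex.reCLM.comp
      (ContinuousLinearMap.proj (R := ℝ) (φ := fun _ : Fin (n + 2) => ℂ) i))).contDiff
  have h2 : ContDiff ℝ ∞ fun ζ : Amb n => ((ζ i).im : ℂ) :=
    (Complex.ofRealCLM.comp (Complex.imCLM.comp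
      (ContinuousLinearMap.proj (R := ℝ) (φ := fun _ : Fin (n + 2) => ℂ) i))).contDiff
  exact h1.add (contDiff_const.mul h2)

theorem contDiff_coneFn : ContDiff ℝ ∞ (coneFn (n := n)) :=
  ContDiff.sum fun i _ => contDiff_const.mul ((contDiff_ambCoord 1 i).mul (contDiff_ambCoord (-1) i))

theorem differentiableAt_of_smoothOn (hU : IsOpen U) (hF : ContDiffOn ℝ ∞ F U) {ζ : Amb n}
    (hζ : ζ ∈ U) : DifferentiableAt ℝ F ζ :=
  (hF.contDiffAt (hU.mem_nhds hζ)).differentiableAt (by simp)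

theorem contDiffOn_fderiv_apply (hU : IsOpen U) (hF : ContDiffOn ℝ ∞ F U) (v : Amb n) :
    ContDiffOn ℝ ∞ (fun ζ => fderiv ℝ F ζ v) U :=
  (hF.fderiv_of_isOpen hU (by simp)).clm_apply contDiffOn_const

theorem contDiffOn_wirtinger (hU : IsOpen U) (hF : ContDiffOn ℝ ∞ F U) (c : ℂ)
    (i : Fin (n + 2)) : ContDiffOn ℝ ∞ (wirtinger c i F) U :=
  contDiffOn_const.mul ((contDiffOn_fderiv_apply hU hF _).add
    (contDiffOn_const.mul (contDiffOn_fderiv_apply hU hF _)))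

theorem contDiffOn_ambLaplacian (hU : IsOpen U) (hF : ContDiffOn ℝ ∞ F U) :
    ContDiffOn ℝ ∞ (ambLaplacian F) U := by
  rw [funext (ambLaplacian_eq F)]
  exact ContDiffOn.sum fun i _ => contDiffOn_const.mul
    (contDiffOn_wirtinger hU (contDiffOn_wirtinger hU hF 1 i) (-1) i)

theorem contDiffOn_ambLaplacian_iterate (hU : IsOpen U) (hF : ContDiffOn ℝ ∞ F U) (k : ℕ) :
    ContDiffOn ℝ ∞ (ambLaplacian^[k] F) U := by
  induction k with
  | zero => exact hF
  | succ k ih =>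
    rw [Function.iterate_succ_apply']
    exact contDiffOn_ambLaplacian hU ih

theorem wirtinger_congr (hU : IsOpen U) (h : Set.EqOn F G U) (c : ℂ) (i : Fin (n + 2)) :
    Set.EqOn (wirtinger c i F) (wirtinger c i G) U := fun ζ hζ => by
  have : F =ᶠ[𝓝 ζ] G := h.eventuallyEq_of_mem (hU.mem_nhds hζ)
  simp only [wirtinger, this.fderiv_eq]

theorem ambLaplacian_congr (hU : IsOpen U) (h : Set.EqOn F G U) :
    Set.EqOn (ambLaplacian F) (ambLaplacian G) U := fun ζ hζ => by
  simp only [ambLaplacian_eq]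
  exact Finset.sum_congr rfl fun i _ => by
    rw [wirtinger_congr hU (wirtinger_congr hU h 1 i) (-1) i hζ]

theorem ambLaplacian_iterate_congr (hU : IsOpen U) (h : Set.EqOn F G U) (k : ℕ) :
    Set.EqOn (ambLaplacian^[k] F) (ambLaplacian^[k] G) U := by
  induction k with
  | zero => exact h
  | succ k ih =>
    rw [Function.iterate_succ_apply', Function.iterate_succ_apply']
    exact ambLaplacian_congr hU ih

theorem euler_congr (hU : IsOpen U) (h : Set.EqOn F G U) (c : ℂ) :
    Set.EqOn (euler c F) (euler c G) U := fun ζ hζ =>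
  Finset.sum_congr rfl fun i _ => by rw [wirtinger_congr hU h c i hζ]

theorem wirtinger_const (c a : ℂ) (i : Fin (n + 2)) (ζ : Amb n) :
    wirtinger c i (fun _ => a) ζ = 0 := by
  simp [wirtinger]

theorem wirtinger_add {ζ : Amb n} (hF : DifferentiableAt ℝ F ζ) (hG : DifferentiableAt ℝ G ζ)
    (c : ℂ) (i : Fin (n + 2)) :
    wirtinger c i (fun η => F η + G η) ζ = wirtinger c i F ζ + wirtinger c i G ζ := by
  simp only [wirtinger, fderiv_fun_add hF hG, add_apply]
  ring

theorem wirtinger_mul {ζ : Amb n} (hF : DifferentiableAt ℝ F ζ) (hG : DifferentiableAt ℝ G ζ)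
    (c : ℂ) (i : Fin (n + 2)) :
    wirtinger c i (fun η => F η * G η) ζ = F ζ * wirtinger c i G ζ + G ζ * wirtinger c i F ζ := by
  simp only [wirtinger, fderiv_fun_mul hF hG, add_apply,
    smul_apply, smul_eq_mul]
  ring

theorem wirtinger_const_mul {ζ : Amb n} (hF : DifferentiableAt ℝ F ζ)
    (c a : ℂ) (i : Fin (n + 2)) :
    wirtinger c i (fun η => a * F η) ζ = a * wirtinger c i F ζ := by
  rw [wirtinger_mul (differentiableAt_const a) hF, wirtinger_const]
  ring

theorem wirtinger_sum {ι : Type*} (s : Finset ι) {H : ι → Amb n → ℂ} {ζ : Amb n}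
    (hH : ∀ a ∈ s, DifferentiableAt ℝ (H a) ζ) (c : ℂ) (i : Fin (n + 2)) :
    wirtinger c i (fun η => ∑ a ∈ s, H a η) ζ = ∑ a ∈ s, wirtinger c i (H a) ζ := by
  simp only [wirtinger, fderiv_fun_sum hH, sum_apply, Finset.mul_sum,
    ← Finset.sum_add_distrib, mul_add]

theorem wirtinger_ambCoord {c c' : ℂ} (i j : Fin (n + 2)) (ζ : Amb n) :
    wirtinger c i (ambCoord c' j) ζ = if i = j then (1 - c * c') / 2 else 0 := by
  let P := ContinuousLinearMap.proj (R := ℝ) (φ := fun _ : Fin (n + 2) => ℂ) j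
  let A : Amb n →L[ℝ] ℂ := Complex.ofRealCLM.comp (Complex.reCLM.comp P) +
    (c' * Complex.I) • Complex.ofRealCLM.comp (Complex.imCLM.comp P)
  have hA : ambCoord c' j = A := by
    funext η; simp [ambCoord, A, P]
  rw [wirtinger, hA, A.fderiv]
  by_cases h : i = j
  · subst h
    simp [A, P]
    linear_combination (1 / 2) * c * c' * Complex.I_mul_I
  · have h' : j ≠ i := fun e => h e.symm
    simp [A, P, h, h']

theorem fderiv_fderiv_apply (hU : IsOpen U) (hF : ContDiffOn ℝ ∞ F U) {ζ : Amb n} (hζ : ζ ∈ U)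
    (v v' : Amb n) :
    fderiv ℝ (fun η => fderiv ℝ F η v) ζ v' = fderiv ℝ (fderiv ℝ F) ζ v' v := by
  have hd : DifferentiableAt ℝ (fderiv ℝ F) ζ :=
    ((hF.fderiv_of_isOpen hU (m := ∞) (by simp)).contDiffAt (hU.mem_nhds hζ)).differentiableAt
      (by simp)
  rw [fderiv_clm_apply hd (differentiableAt_const v)]
  simp

theorem wirtinger_comm (hU : IsOpen U) (hF : ContDiffOn ℝ ∞ F U) (c c' : ℂ)
    (i j : Fin (n + 2)) :
    Set.EqOn (wirtinger c i (wirtinger c' j F)) (wirtinger c' j (wirtinger c i F)) U := by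
  intro ζ hζ
  have hs : IsSymmSndFDerivAt ℝ F ζ :=
    (hF.contDiffAt (hU.mem_nhds hζ)).isSymmSndFDerivAt (by
      rw [minSmoothness_of_isRCLikeNormedField]
      exact WithTop.coe_le_coe.2 le_top)
  have key : ∀ (b : ℂ) (m : Fin (n + 2)) (v : Amb n),
      fderiv ℝ (wirtinger b m F) ζ v = (1 / 2) * (fderiv ℝ (fderiv ℝ F) ζ v (Pi.single m 1) +
        b * Complex.I * fderiv ℝ (fderiv ℝ F) ζ v (Pi.single m Complex.I)) := by
    intro b m v
    have h1 : ∀ v, DifferentiableAt ℝ (fun η => fderiv ℝ F η v) ζ := fun v =>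
      differentiableAt_of_smoothOn hU (contDiffOn_fderiv_apply hU hF v) hζ
    rw [← fderiv_fderiv_apply hU hF hζ, ← fderiv_fderiv_apply hU hF hζ]
    unfold wirtinger
    rw [fderiv_const_mul ((h1 _).fun_add ((h1 _).const_mul _)),
      fderiv_fun_add (h1 _) ((h1 _).const_mul _), fderiv_const_mul (h1 _)]
    simp only [smul_apply, add_apply, smul_eq_mul]
  rw [wirtinger, wirtinger, key, key, key, key]
  rw [hs (Pi.single i 1) (Pi.single j 1), hs (Pi.single i 1) (Pi.single j Complex.I),
    hs (Pi.single i Complex.I) (Pi.single j 1), hs (Pi.single i Complex.I) (Pi.single j Complex.I)]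
  ring

end CRSphere

namespace CRSphere

variable {n : ℕ} {U : Set (Amb n)} {F G : Amb n → ℂ}

/-! ### Commutation relations of the Laplacian -/

theorem ambLaplacian_add (hU : IsOpen U) (hF : ContDiffOn ℝ ∞ F U) (hG : ContDiffOn ℝ ∞ G U) :
    Set.EqOn (ambLaplacian fun η => F η + G η) (fun η => ambLaplacian F η + ambLaplacian G η) U := by
  intro ζ hζ
  simp only [ambLaplacian_eq, ← Finset.sum_add_distrib]
  refine Finset.sum_congr rfl fun i _ => ?_
  have h : Set.EqOn (wirtinger 1 i fun η => F η + G η)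
      (fun η => wirtinger 1 i F η + wirtinger 1 i G η) U := fun η hη =>
    wirtinger_add (differentiableAt_of_smoothOn hU hF hη) (differentiableAt_of_smoothOn hU hG hη) _ _
  rw [wirtinger_congr hU h (-1) i hζ, wirtinger_add
    (differentiableAt_of_smoothOn hU (contDiffOn_wirtinger hU hF 1 i) hζ)
    (differentiableAt_of_smoothOn hU (contDiffOn_wirtinger hU hG 1 i) hζ)]
  ring

theorem ambLaplacian_const_mul (hU : IsOpen U) (hF : ContDiffOn ℝ ∞ F U) (a : ℂ) :
    Set.EqOn (ambLaplacian fun η => a * F η) (fun η => a * ambLaplacian F η) U := by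
  intro ζ hζ
  simp only [ambLaplacian_eq, Finset.mul_sum]
  refine Finset.sum_congr rfl fun i _ => ?_
  have h : Set.EqOn (wirtinger 1 i fun η => a * F η) (fun η => a * wirtinger 1 i F η) U :=
    fun η hη => wirtinger_const_mul (differentiableAt_of_smoothOn hU hF hη) _ _ _
  rw [wirtinger_congr hU h (-1) i hζ, wirtinger_const_mul
    (differentiableAt_of_smoothOn hU (contDiffOn_wirtinger hU hF 1 i) hζ)]
  ring

theorem ambLaplacian_sum (hU : IsOpen U) {ι : Type*} (s : Finset ι) {H : ι → Amb n → ℂ}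
    (hH : ∀ a, ContDiffOn ℝ ∞ (H a) U) :
    Set.EqOn (ambLaplacian fun η => ∑ a ∈ s, H a η) (fun η => ∑ a ∈ s, ambLaplacian (H a) η) U := by
  classical
  induction s using Finset.induction_on with
  | empty =>
    intro ζ _
    have h : ∀ i : Fin (n + 2), wirtinger 1 i (fun _ : Amb n => (0 : ℂ)) = fun _ => 0 :=
      fun i => funext fun η => wirtinger_const 1 0 i η
    simp [ambLaplacian_eq, h, wirtinger_const]
  | insert a s ha ih =>
    intro ζ hζ
    simp only [Finset.sum_insert ha]
    rw [ambLaplacian_add hU (hH a) (ContDiffOn.sum fun b _ => hH b) hζ]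
    beta_reduce
    rw [ih hζ]

theorem ambLaplacian_iterate_add (hU : IsOpen U) (hF : ContDiffOn ℝ ∞ F U)
    (hG : ContDiffOn ℝ ∞ G U) (k : ℕ) :
    Set.EqOn (ambLaplacian^[k] fun η => F η + G η)
      (fun η => ambLaplacian^[k] F η + ambLaplacian^[k] G η) U := by
  induction k generalizing F G with
  | zero => exact fun _ _ => rfl
  | succ k ih =>
    simp only [Function.iterate_succ_apply]
    exact (ambLaplacian_iterate_congr hU (ambLaplacian_add hU hF hG) k).trans
      (ih (contDiffOn_ambLaplacian hU hF) (contDiffOn_ambLaplacian hU hG))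

theorem ambLaplacian_iterate_const_mul (hU : IsOpen U) (hF : ContDiffOn ℝ ∞ F U) (a : ℂ) (k : ℕ) :
    Set.EqOn (ambLaplacian^[k] fun η => a * F η) (fun η => a * ambLaplacian^[k] F η) U := by
  induction k generalizing F with
  | zero => exact fun _ _ => rfl
  | succ k ih =>
    simp only [Function.iterate_succ_apply]
    exact (ambLaplacian_iterate_congr hU (ambLaplacian_const_mul hU hF a) k).trans
      (ih (contDiffOn_ambLaplacian hU hF))

theorem wirtinger_ambLaplacian (hU : IsOpen U) (hF : ContDiffOn ℝ ∞ F U) (c : ℂ)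
    (i : Fin (n + 2)) :
    Set.EqOn (wirtinger c i (ambLaplacian F)) (ambLaplacian (wirtinger c i F)) U := by
  intro ζ hζ
  have hd : ∀ j : Fin (n + 2), DifferentiableAt ℝ (wirtinger (-1) j (wirtinger 1 j F)) ζ :=
    fun j => differentiableAt_of_smoothOn hU
      (contDiffOn_wirtinger hU (contDiffOn_wirtinger hU hF 1 j) (-1) j) hζ
  rw [funext (ambLaplacian_eq F), wirtinger_sum _ fun j _ => (hd j).const_mul _, ambLaplacian_eq]
  refine Finset.sum_congr rfl fun j _ => ?_
  rw [wirtinger_const_mul (hd j), wirtinger_comm hU (contDiffOn_wirtinger hU hF 1 j) c (-1) i j hζ,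
    wirtinger_congr hU (wirtinger_comm hU hF c 1 i j) (-1) j hζ]

/-- One of the two derivatives in each summand kills the coordinate, so the product rule leaves a
single cross term, at `j = i`. Multiplication by `ζ_i` (`c = 1`) leaves `∂/∂ζ̄_i`; multiplication by
`ζ̄_i` (`c = -1`) leaves `∂/∂ζ_i`. -/
theorem ambLaplacian_ambCoord_mul (hU : IsOpen U) (hF : ContDiffOn ℝ ∞ F U) {c : ℂ}
    (hc : c * c = 1) (i : Fin (n + 2)) :
    Set.EqOn (ambLaplacian fun η => ambCoord c i η * F η)
      (fun η => ambCoord c i η * ambLaplacian F η + -2 * signature i * wirtinger c i F η) U := by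
  intro ζ hζ
  have hY : ∀ η, DifferentiableAt ℝ (ambCoord (n := n) c i) η := fun η =>
    (contDiff_ambCoord c i).differentiable (by simp) η
  have hdF : ∀ η ∈ U, DifferentiableAt ℝ F η := fun η hη => differentiableAt_of_smoothOn hU hF hη
  have hW := fun j : Fin (n + 2) => contDiffOn_wirtinger hU hF 1 j
  have hdW : ∀ j : Fin (n + 2), DifferentiableAt ℝ (wirtinger 1 j F) ζ := fun j =>
    differentiableAt_of_smoothOn hU (hW j) hζ
  have h1 : ∀ j, wirtinger (-1) j (wirtinger 1 j fun η => ambCoord c i η * F η) ζ =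
      ambCoord c i ζ * wirtinger (-1) j (wirtinger 1 j F) ζ +
        if j = i then wirtinger c j F ζ else 0 := fun j => by
    have h : Set.EqOn (wirtinger 1 j fun η => ambCoord c i η * F η)
        (fun η => ambCoord c i η * wirtinger 1 j F η + (if j = i then (1 - 1 * c) / 2 else 0) * F η)
        U := fun η hη => by
      rw [wirtinger_mul (hY η) (hdF η hη), wirtinger_ambCoord]
      ring
    rw [wirtinger_congr hU h (-1) j hζ, wirtinger_add ((hY ζ).fun_mul (hdW j))
      ((hdF ζ hζ).const_mul _), wirtinger_mul (hY ζ) (hdW j), wirtinger_const_mul (hdF ζ hζ),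
      wirtinger_ambCoord]
    split_ifs with hji
    · have : c = 1 ∨ c = -1 := mul_self_eq_one_iff.1 hc
      rcases this with rfl | rfl <;> ring
    · ring
  simp only [ambLaplacian_eq, h1, mul_add, Finset.sum_add_distrib, Finset.mul_sum]
  congr 1
  · exact Finset.sum_congr rfl fun j _ => by ring
  · simp

/-- The first-order commutator commutes with the Laplacian, so each of the `k + 1` factors
contributes the same term. -/
theorem ambLaplacian_iterate_ambCoord_mul (hU : IsOpen U) (hF : ContDiffOn ℝ ∞ F U) {c : ℂ}
    (hc : c * c = 1) (i : Fin (n + 2)) (k : ℕ) :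
    Set.EqOn (ambLaplacian^[k + 1] fun η => ambCoord c i η * F η)
      (fun η => ambCoord c i η * ambLaplacian^[k + 1] F η +
        (k + 1) * (-2 * signature i) * wirtinger c i (ambLaplacian^[k] F) η) U := by
  induction k with
  | zero =>
    intro ζ hζ
    simpa using ambLaplacian_ambCoord_mul hU hF hc i hζ
  | succ k ih =>
    intro ζ hζ
    have hk := contDiffOn_ambLaplacian_iterate hU hF k
    have hk1 := contDiffOn_ambLaplacian_iterate hU hF (k + 1)
    rw [Function.iterate_succ_apply', ambLaplacian_congr hU ih hζ,
      ambLaplacian_add hU ((contDiff_ambCoord c i).contDiffOn.mul hk1)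
        (contDiffOn_const.mul (contDiffOn_wirtinger hU hk c i)) hζ]
    beta_reduce
    rw [ambLaplacian_const_mul hU (contDiffOn_wirtinger hU hk c i) _ hζ]
    beta_reduce
    rw [ambLaplacian_ambCoord_mul hU hk1 hc i hζ, ← wirtinger_ambLaplacian hU hk c i hζ,
      ← Function.iterate_succ_apply' ambLaplacian k, ← Function.iterate_succ_apply' ambLaplacian]
    push_cast
    ring

/-- Apply the coordinate relation twice to each `ε_i ζ_i ζ̄_i`: as `ε_i² = 1`, the first-order terms
add up to the two Euler fields, and each of the `n + 2` coordinates contributes one copy of `F`. -/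
theorem ambLaplacian_coneFn_mul (hU : IsOpen U) (hF : ContDiffOn ℝ ∞ F U) :
    Set.EqOn (ambLaplacian fun η => coneFn η * F η)
      (fun η => coneFn η * ambLaplacian F η +
        -2 * (euler (-1) F η + euler 1 F η + (n + 2) * F η)) U := by
  intro ζ hζ
  have hs : (fun η => coneFn η * F η) = fun η => ∑ i, signature i *
      (ambCoord 1 i η * (ambCoord (-1) i η * F η)) := by
    funext η
    rw [coneFn, Finset.sum_mul]
    exact Finset.sum_congr rfl fun i _ => by ring
  have h1 : ∀ i : Fin (n + 2), ContDiffOn ℝ ∞ (fun η => ambCoord (-1) i η * F η) U :=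
    fun i => (contDiff_ambCoord _ i).contDiffOn.mul hF
  have h2 : ∀ i : Fin (n + 2),
      ContDiffOn ℝ ∞ (fun η => ambCoord 1 i η * (ambCoord (-1) i η * F η)) U :=
    fun i => (contDiff_ambCoord _ i).contDiffOn.mul (h1 i)
  rw [hs, ambLaplacian_sum hU _ (fun i => contDiffOn_const.mul (h2 i)) hζ]
  have h3 : ∀ i : Fin (n + 2),
      ambLaplacian (fun η => signature i * (ambCoord 1 i η * (ambCoord (-1) i η * F η))) ζ =
        signature i * (ambCoord 1 i ζ * ambCoord (-1) i ζ) * ambLaplacian F ζ +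
          -2 * (ambCoord 1 i ζ * wirtinger (-1) i F ζ + ambCoord (-1) i ζ * wirtinger 1 i F ζ +
            F ζ) := fun i => by
    rw [ambLaplacian_const_mul hU (h2 i) _ hζ]
    beta_reduce
    rw [ambLaplacian_ambCoord_mul hU (h1 i) (by norm_num) i hζ]
    beta_reduce
    rw [ambLaplacian_ambCoord_mul hU hF (by norm_num) i hζ,
      wirtinger_mul ((contDiff_ambCoord _ i).differentiable (by simp) ζ)
        (differentiableAt_of_smoothOn hU hF hζ), wirtinger_ambCoord]
    have := signature_mul_self i
    simp only [if_true]
    linear_combination (-2 * (ambCoord 1 i ζ * wirtinger (-1) i F ζ +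
      ambCoord (-1) i ζ * wirtinger 1 i F ζ + F ζ)) * this
  simp only [h3, Finset.sum_add_distrib, ← Finset.mul_sum, ← Finset.sum_mul, coneFn, euler, neg_neg]
  simp

/-! ### Homogeneous functions -/

/-- Apply `Δ` to the Euler equation: the coordinate relation, summed over `i`, says that the
commutator of `Δ` with either Euler field is `Δ` itself. -/
theorem euler_ambLaplacian (hU : IsOpen U) (hF : ContDiffOn ℝ ∞ F U) {c w : ℂ} (hc : c * c = 1)
    (h : Set.EqOn (euler c F) (fun η => w * F η) U) :
    Set.EqOn (euler c (ambLaplacian F)) (fun η => (w - 1) * ambLaplacian F η) U := by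
  intro ζ hζ
  have h1 := ambLaplacian_congr hU h hζ
  have hW := fun i : Fin (n + 2) => contDiffOn_wirtinger hU hF c i
  rw [ambLaplacian_const_mul hU hF w hζ] at h1
  unfold euler at h1
  rw [ambLaplacian_sum hU _ (fun i => (contDiff_ambCoord (-c) i).contDiffOn.mul (hW i)) hζ] at h1
  have h2 : ∀ i : Fin (n + 2), ambLaplacian (fun η => ambCoord (-c) i η * wirtinger c i F η) ζ =
      ambCoord (-c) i ζ * wirtinger c i (ambLaplacian F) ζ +
        -2 * signature i * wirtinger (-1) i (wirtinger 1 i F) ζ := fun i => by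
    rw [ambLaplacian_ambCoord_mul hU (hW i) (by rw [neg_mul_neg, hc]) i hζ,
      wirtinger_ambLaplacian hU hF c i hζ]
    rcases mul_self_eq_one_iff.1 hc with rfl | rfl
    · rfl
    · beta_reduce
      rw [neg_neg, wirtinger_comm hU hF 1 (-1) i i hζ]
  simp only [h2, Finset.sum_add_distrib, ← ambLaplacian_eq] at h1
  simp only [euler]
  linear_combination h1

theorem euler_ambLaplacian_iterate (hU : IsOpen U) (hF : ContDiffOn ℝ ∞ F U) {c w : ℂ}
    (hc : c * c = 1) (h : Set.EqOn (euler c F) (fun η => w * F η) U) (k : ℕ) :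
    Set.EqOn (euler c (ambLaplacian^[k] F)) (fun η => (w - k) * ambLaplacian^[k] F η) U := by
  induction k with
  | zero => simpa using h
  | succ k ih =>
    intro ζ hζ
    simp only [Function.iterate_succ_apply']
    rw [euler_ambLaplacian hU (contDiffOn_ambLaplacian_iterate hU hF k) hc ih hζ]
    push_cast
    ring

/-- Each application of `Δ` lowers the total degree `a + b` by two, so the scalar is the arithmetic
sum of `-2 (a + b - 2j + n + 2)` over `0 ≤ j < k`. -/
theorem ambLaplacian_iterate_coneFn_mul (hU : IsOpen U) (hF : ContDiffOn ℝ ∞ F U) {a b : ℂ}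
    (ha : Set.EqOn (euler (-1) F) (fun η => a * F η) U)
    (hb : Set.EqOn (euler 1 F) (fun η => b * F η) U) (k : ℕ) :
    Set.EqOn (ambLaplacian^[k] fun η => coneFn η * F η)
      (fun η => coneFn η * ambLaplacian^[k] F η +
        -2 * k * (a + b + n + 3 - k) * ambLaplacian^[k - 1] F η) U := by
  induction k generalizing F a b with
  | zero => intro ζ _; simp
  | succ k ih =>
    have h1 : Set.EqOn (ambLaplacian fun η => coneFn η * F η)
        (fun η => coneFn η * ambLaplacian F η + -2 * (a + b + n + 2) * F η) U := fun ζ hζ => by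
      rw [ambLaplacian_coneFn_mul hU hF hζ]
      beta_reduce
      rw [ha hζ, hb hζ]
      ring
    have hL := contDiffOn_ambLaplacian hU hF
    intro ζ hζ
    rw [Function.iterate_succ_apply, ambLaplacian_iterate_congr hU h1 k hζ,
      ambLaplacian_iterate_add hU (contDiff_coneFn.contDiffOn.mul hL) (contDiffOn_const.mul hF) k hζ]
    beta_reduce
    rw [ambLaplacian_iterate_const_mul hU hF _ k hζ]
    beta_reduce
    rw [ih hL (euler_ambLaplacian hU hF (by norm_num) ha)
      (euler_ambLaplacian hU hF (by norm_num) hb) hζ]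
    simp only [Function.iterate_succ_apply, Nat.add_sub_cancel]
    -- For `k = 0` the exponent `k - 1` is truncated, but its coefficient contains the factor `k`.
    rcases k with _ | k
    · push_cast
      simp only [Function.iterate_zero, id_eq]
      ring
    · simp only [Nat.add_sub_cancel, Function.iterate_succ_apply]
      push_cast
      ring

theorem euler_mul {ζ : Amb n} (hF : DifferentiableAt ℝ F ζ) (hG : DifferentiableAt ℝ G ζ) (c : ℂ) :
    euler c (fun η => F η * G η) ζ = F ζ * euler c G ζ + G ζ * euler c F ζ := by
  simp only [euler, wirtinger_mul hF hG, Finset.mul_sum, ← Finset.sum_add_distrib]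
  exact Finset.sum_congr rfl fun i _ => by ring

theorem euler_ambCoord (c c' : ℂ) (i : Fin (n + 2)) (ζ : Amb n) :
    euler c (ambCoord c' i) ζ = ambCoord (-c) i ζ * ((1 - c * c') / 2) := by
  simp [euler, wirtinger_ambCoord]

theorem euler_coneFn {c : ℂ} (hc : c * c = 1) (ζ : Amb n) : euler c coneFn ζ = coneFn ζ := by
  have hY : ∀ (c : ℂ) (i : Fin (n + 2)), DifferentiableAt ℝ (ambCoord c i) ζ := fun c i =>
    (contDiff_ambCoord c i).differentiable (by simp) ζ
  have h : ∀ j i : Fin (n + 2), wirtinger c j (fun η => signature i *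
      (ambCoord 1 i η * ambCoord (-1) i η)) ζ = if j = i then signature i * ambCoord c i ζ else 0 := by
    intro j i
    rw [wirtinger_const_mul ((hY 1 i).fun_mul (hY (-1) i)), wirtinger_mul (hY 1 i) (hY (-1) i),
      wirtinger_ambCoord, wirtinger_ambCoord]
    split_ifs
    · rcases mul_self_eq_one_iff.1 hc with rfl | rfl <;> ring
    · ring
  unfold euler
  rw [coneFn]
  refine Finset.sum_congr rfl fun j _ => ?_
  unfold coneFn
  rw [wirtinger_sum _ fun i _ => ((hY 1 i).fun_mul (hY (-1) i)).const_mul _]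
  simp only [h, Finset.sum_ite_eq, Finset.mem_univ, if_true]
  rcases mul_self_eq_one_iff.1 hc with rfl | rfl
  · ring
  · rw [neg_neg]; ring

/-- The complement of the null cone is dense. -/
theorem eq_zero_of_coneFn_mul_eq_zero (hU : IsOpen U) (hF : ContinuousOn F U)
    (h : ∀ ζ ∈ U, coneFn ζ * F ζ = 0) {ζ : Amb n} (hζ : ζ ∈ U) : F ζ = 0 := by
  by_contra hne
  have hV : IsOpen (U ∩ F ⁻¹' {0}ᶜ) := hF.isOpen_inter_preimage hU isOpen_compl_singleton
  have hζV : ζ ∈ U ∩ F ⁻¹' {0}ᶜ := ⟨hζ, hne⟩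
  -- Where `F` is nonzero, `r` would vanish on an open set, contradicting `Δ r = -2 (n + 2)`.
  have h0 : Set.EqOn (fun η : Amb n => coneFn η * (1 : ℂ)) (fun _ => 0) (U ∩ F ⁻¹' {0}ᶜ) :=
    fun η hη => by
      have := (mul_eq_zero.1 (h η hη.1)).resolve_right hη.2
      simp [this]
  have hL : ∀ a : ℂ, ambLaplacian (fun _ : Amb n => a) = fun _ => 0 := fun a => by
    have h' : ∀ i : Fin (n + 2), wirtinger 1 i (fun _ : Amb n => a) = fun _ => 0 :=
      fun i => funext fun η => wirtinger_const 1 a i η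
    funext η
    simp [ambLaplacian_eq, h', wirtinger_const]
  have h1 := ambLaplacian_coneFn_mul hV (F := fun _ => 1) contDiffOn_const hζV
  rw [ambLaplacian_congr hV h0 hζV] at h1
  simp only [hL, euler, wirtinger_const] at h1
  have : ((n : ℂ) + 2) ≠ 0 := by exact_mod_cast (n + 1).succ_ne_zero
  simp at h1
  exact this h1

/-- If `H = r G` is homogeneous, then `Δ^k H` vanishes on the null cone in the critical weight. -/
theorem ambLaplacian_iterate_coneFn_mul_eq_zero (hU : IsOpen U) (hG : ContDiffOn ℝ ∞ G U)
    {H : Amb n → ℂ} (hH : Set.EqOn H (fun η => coneFn η * G η) U) {w w' : ℂ}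
    (h : Set.EqOn (euler (-1) H) (fun η => w * H η) U)
    (h' : Set.EqOn (euler 1 H) (fun η => w' * H η) U) {k : ℕ} (hk : (k : ℂ) = w + w' + n + 1)
    {ζ : Amb n} (hζ : ζ ∈ U) (h0 : coneFn ζ = 0) : (ambLaplacian^[k] H) ζ = 0 := by
  -- The quotient `G` is homogeneous of bidegree `(w - 1, w' - 1)`: the Euler equation for `r G` is
  -- `r` times the one for `G`, and `r` can be cancelled by density.
  have key : ∀ c v : ℂ, c * c = 1 → Set.EqOn (euler c H) (fun η => v * H η) U →
      Set.EqOn (euler c G) (fun η => (v - 1) * G η) U := by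
    intro c v hc hv η hη
    refine sub_eq_zero.1 (eq_zero_of_coneFn_mul_eq_zero (F := fun η => euler c G η - (v - 1) * G η)
      hU ?_ (fun ξ hξ => ?_) hη)
    · have : ContDiffOn ℝ ∞ (euler c G) U := ContDiffOn.sum fun i _ =>
        (contDiff_ambCoord (-c) i).contDiffOn.mul (contDiffOn_wirtinger hU hG c i)
      exact this.continuousOn.sub (continuousOn_const.mul hG.continuousOn)
    · have h1 := hv hξ
      rw [euler_congr hU hH c hξ, euler_mul (contDiff_coneFn.differentiable (by simp) ξ)
        (differentiableAt_of_smoothOn hU hG hξ), euler_coneFn hc] at h1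
      simp only [hH hξ] at h1
      linear_combination h1
  rw [ambLaplacian_iterate_congr hU hH k hζ, ambLaplacian_iterate_coneFn_mul hU hG
    (key _ _ (by norm_num) h) (key _ _ (by norm_num) h') k hζ]
  -- The remaining scalar is `(w - 1) + (w' - 1) + n + 3 - k`, which is zero by `hk`.
  simp only [h0]
  linear_combination (-2 * k * ambLaplacian^[k - 1] G ζ) * (-hk)

end CRSphere

/-! ### Coordinates on the null cone and on the sphere -/

namespace CRSphere

variable {n : ℕ}

open Classical in
/-- Radial projection onto the sphere, with an arbitrary value `z` at the origin. -/
noncomputable def sphProj (z : Sph n) (x : EuclideanSpace ℂ (Fin (n + 1))) : Sph n :=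
  if h : x = 0 then z else ⟨(‖x‖⁻¹ : ℝ) • x, by
    rw [mem_sphere_zero_iff_norm, norm_smul, norm_inv, norm_norm,
      inv_mul_cancel₀ (norm_ne_zero_iff.2 h)]⟩

theorem coe_sphProj (z : Sph n) {x : EuclideanSpace ℂ (Fin (n + 1))} (hx : x ≠ 0) :
    (sphProj z x : EuclideanSpace ℂ (Fin (n + 1))) = (‖x‖⁻¹ : ℝ) • x := by
  simp [sphProj, hx]

theorem sphProj_coe (z y : Sph n) : sphProj z y = y := by
  have hy : ‖(y : EuclideanSpace ℂ (Fin (n + 1)))‖ = 1 := norm_eq_of_mem_sphere y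
  apply Subtype.ext
  rw [coe_sphProj z (norm_ne_zero_iff.1 (by rw [hy]; exact one_ne_zero)), hy, inv_one, one_smul]

theorem contMDiffAt_sphProj (z : Sph n) {x : EuclideanSpace ℂ (Fin (n + 1))} (hx : x ≠ 0) :
    ContMDiffAt 𝓘(ℝ, EuclideanSpace ℂ (Fin (n + 1))) (𝓡 (2 * n + 1)) ∞ (sphProj z) x := by
  -- `ContMDiff.codRestrict_sphere` takes an everywhere smooth map, hence the passage to the open
  -- submanifold of nonzero vectors.
  let V : TopologicalSpace.Opens (EuclideanSpace ℂ (Fin (n + 1))) := ⟨{0}ᶜ, isOpen_compl_singleton⟩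
  have h1 : ContMDiff 𝓘(ℝ, EuclideanSpace ℂ (Fin (n + 1))) 𝓘(ℝ, EuclideanSpace ℂ (Fin (n + 1))) ∞
      (fun y : V => (‖(y : EuclideanSpace ℂ (Fin (n + 1)))‖⁻¹ : ℝ) •
        (y : EuclideanSpace ℂ (Fin (n + 1)))) := fun y => by
    refine (contMDiffAt_subtype_iff (f := fun y : EuclideanSpace ℂ (Fin (n + 1)) =>
      (‖y‖⁻¹ : ℝ) • y)).2 (ContDiffAt.contMDiffAt ?_)
    have hy : (y : EuclideanSpace ℂ (Fin (n + 1))) ≠ 0 := y.2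
    exact ((contDiffAt_id.norm ℝ hy).inv (norm_ne_zero_iff.2 hy)).smul contDiffAt_id
  have h2 := h1.codRestrict_sphere (n := 2 * n + 1) fun y => by
    rw [mem_sphere_zero_iff_norm, norm_smul, norm_inv, norm_norm,
      inv_mul_cancel₀ (norm_ne_zero_iff.2 y.2)]
  refine (contMDiffAt_subtype_iff (U := V) (x := ⟨x, hx⟩)).1 ?_
  refine (h2 ⟨x, hx⟩).congr_of_eventuallyEq (Filter.Eventually.of_forall fun y => ?_)
  exact Subtype.ext (coe_sphProj z y.2)

theorem contDiffAt_comp_sphProj {u : Sph n → ℂ} (hu : SmoothOnSphere n u) (z : Sph n)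
    {x : EuclideanSpace ℂ (Fin (n + 1))} (hx : x ≠ 0) :
    ContDiffAt ℝ ∞ (fun y => u (sphProj z y)) x :=
  ((hu _).comp x (contMDiffAt_sphProj z hx)).contDiffAt

/-- The affine coordinates `ζ_j / ζ_0`. -/
noncomputable def affineCoord (ζ : Amb n) : EuclideanSpace ℂ (Fin (n + 1)) :=
  WithLp.toLp 2 fun j => ζ j.succ / ζ 0

theorem contDiffAt_affineCoord {ζ : Amb n} (h : ζ 0 ≠ 0) :
    ContDiffAt ℝ ∞ (affineCoord (n := n)) ζ := by
  refine (PiLp.continuousLinearEquiv 2 ℝ (fun _ : Fin (n + 1) => ℂ)).symm.contDiff.contDiffAt.comp ζ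
    (contDiffAt_pi.2 fun j => ?_)
  have hc : ∀ i : Fin (n + 2), ContDiffAt ℝ ∞ (fun η : Amb n => η i) ζ := fun i =>
    (contDiff_apply ℝ ℂ i).contDiffAt
  simp only [div_eq_mul_inv]
  exact (hc j.succ).mul ((hc 0).inv h)

theorem affineCoord_homCoord {z₀ : ℂ} (h : z₀ ≠ 0) (z : Sph n) :
    affineCoord (homCoord z₀ z) = z := by
  ext j
  simp [affineCoord, homCoord, coord, h]

theorem norm_sq_affineCoord (ζ : Amb n) :
    ‖affineCoord ζ‖ ^ 2 = (∑ j : Fin (n + 1), ‖ζ j.succ‖ ^ 2) / ‖ζ 0‖ ^ 2 := by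
  simp [EuclideanSpace.norm_sq_eq, affineCoord, div_pow, Finset.sum_div]

theorem coe_ne_zero (z : Sph n) : (z : EuclideanSpace ℂ (Fin (n + 1))) ≠ 0 :=
  ne_zero_of_mem_unit_sphere z

theorem sum_norm_sq_coord (z : Sph n) : ∑ j, ‖coord j z‖ ^ 2 = 1 := by
  have := EuclideanSpace.norm_sq_eq (z : EuclideanSpace ℂ (Fin (n + 1)))
  rw [norm_eq_of_mem_sphere z] at this
  simpa [coord] using this.symm

theorem homCoord_one_zero (z : Sph n) : homCoord 1 z 0 = 1 := rfl

theorem homCoord_one_succ (z : Sph n) (j : Fin (n + 1)) : homCoord 1 z j.succ = coord j z := by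
  simp [homCoord]

theorem coneFn_homCoord_one (z : Sph n) : coneFn (homCoord 1 z) = 0 := by
  rw [coneFn_eq]
  simp only [homCoord_one_zero, homCoord_one_succ, sum_norm_sq_coord]
  simp

/-- On the cone the vector `ζ_j / ζ_0` already has norm one, so the radial projection does not move
it. -/
theorem homCoord_sphProj_affineCoord (z : Sph n) {ζ : Amb n} (h : ζ 0 ≠ 0) (h0 : coneFn ζ = 0) :
    homCoord (ζ 0) (sphProj z (affineCoord ζ)) = ζ := by
  have h1 : ‖affineCoord ζ‖ = 1 := by
    rw [coneFn_eq, Complex.ofReal_eq_zero] at h0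
    have h2 : ∑ j : Fin (n + 1), ‖ζ j.succ‖ ^ 2 = ‖ζ 0‖ ^ 2 := by linarith
    have h3 := norm_sq_affineCoord ζ
    rw [h2, div_self (pow_ne_zero 2 (norm_ne_zero_iff.2 h))] at h3
    exact (pow_eq_one_iff_of_nonneg (norm_nonneg _) two_ne_zero).1 h3
  have h2 : (sphProj z (affineCoord ζ) : EuclideanSpace ℂ (Fin (n + 1))) = affineCoord ζ := by
    rw [coe_sphProj z (norm_ne_zero_iff.1 (by rw [h1]; exact one_ne_zero)), h1, inv_one, one_smul]
  funext i
  refine Fin.cases rfl (fun j => ?_) i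
  simp only [homCoord, Fin.cons_succ, coord, h2]
  simp [affineCoord, mul_div_cancel₀ _ h]

theorem tendsto_affine (z : Sph n) :
    Filter.Tendsto (fun ζ : Amb n => (ζ 0, sphProj z (affineCoord ζ))) (𝓝 (homCoord 1 z))
      (𝓝 (1, z)) := by
  have h1 : ContinuousAt (fun ζ : Amb n => ζ 0) (homCoord 1 z) := (continuous_apply 0).continuousAt
  have h2 : ContinuousAt (affineCoord (n := n)) (homCoord 1 z) :=
    (contDiffAt_affineCoord (by rw [homCoord_one_zero]; exact one_ne_zero)).continuousAt
  have h3 : affineCoord (homCoord 1 z) = z := affineCoord_homCoord one_ne_zero z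
  have h4 : ContinuousAt (sphProj z) (affineCoord (homCoord 1 z)) := by
    rw [h3]; exact (contMDiffAt_sphProj z (coe_ne_zero z)).continuousAt
  have h5 : ContinuousAt (fun ζ : Amb n => (ζ 0, sphProj z (affineCoord ζ))) (homCoord 1 z) :=
    h1.prodMk (ContinuousAt.comp (f := affineCoord) h4 h2)
  have h6 := h5.tendsto
  rwa [h3, sphProj_coe, homCoord_one_zero] at h6

theorem eventually_zero_coord_ne_zero (z : Sph n) : ∀ᶠ ζ : Amb n in 𝓝 (homCoord 1 z), ζ 0 ≠ 0 :=
  (continuous_apply 0).continuousAt.eventually_ne (by rw [homCoord_one_zero]; exact one_ne_zero)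

/-- A condition on the null cone, in terms of homogeneous coordinates. -/
theorem eventually_of_homCoord {z : Sph n} {p : Amb n → Prop}
    (h : ∀ᶠ q : ℂ × Sph n in 𝓝 (1, z), p (homCoord q.1 q.2)) :
    ∀ᶠ ζ in 𝓝 (homCoord 1 z), coneFn ζ = 0 → p ζ := by
  filter_upwards [(tendsto_affine z).eventually h, eventually_zero_coord_ne_zero z] with ζ h1 h2 h3
  rwa [homCoord_sphProj_affineCoord z h2 h3] at h1

end CRSphere

/-! ### Division by the defining function and independence of the extension -/

namespace CRSphere

variable {n : ℕ}

/-- `∑_{j ≥ 1} |ζ_j|²`. -/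
noncomputable def spaceNormSq (ζ : Amb n) : ℝ := ∑ j : Fin (n + 1), ‖ζ j.succ‖ ^ 2

/-- Rescaling of `ζ_1, …, ζ_{n+1}` to the hypersurface `-|ζ_0|² + ∑ |ζ_j|² = t`. -/
noncomputable def moveToLevel (q : Amb n × ℝ) : Amb n :=
  Fin.cons (q.1 0) fun j =>
    (√((‖q.1 0‖ ^ 2 + q.2) / spaceNormSq q.1) : ℂ) * q.1 j.succ

theorem contDiff_coord_norm_sq (i : Fin (n + 2)) : ContDiff ℝ ∞ fun ζ : Amb n => ‖ζ i‖ ^ 2 :=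
  (contDiff_norm_sq ℝ).comp (contDiff_apply ℝ ℂ i)

theorem contDiff_spaceNormSq : ContDiff ℝ ∞ (spaceNormSq (n := n)) :=
  ContDiff.sum fun j _ => contDiff_coord_norm_sq j.succ

theorem contDiffAt_moveToLevel {q : Amb n × ℝ} (h : 0 < ‖q.1 0‖ ^ 2 + q.2)
    (h' : 0 < spaceNormSq q.1) : ContDiffAt ℝ ∞ (moveToLevel (n := n)) q := by
  have hc : ∀ i : Fin (n + 2), ContDiffAt ℝ ∞ (fun q : Amb n × ℝ => q.1 i) q := fun i =>
    ((contDiff_apply ℝ ℂ i).comp contDiff_fst).contDiffAt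
  refine contDiffAt_pi.2 fun i => Fin.cases (hc 0) (fun j => ?_) i
  have h1 : ContDiffAt ℝ ∞ (fun q : Amb n × ℝ => (‖q.1 0‖ ^ 2 + q.2) / spaceNormSq q.1) q :=
    ContDiffAt.div (((contDiff_coord_norm_sq 0).comp contDiff_fst).add contDiff_snd).contDiffAt
      (contDiff_spaceNormSq.comp contDiff_fst).contDiffAt h'.ne'
  exact (Complex.ofRealCLM.contDiff.contDiffAt.comp q (h1.sqrt (div_pos h h').ne')).mul (hc j.succ)

theorem coneFn_moveToLevel {q : Amb n × ℝ} (h : 0 < ‖q.1 0‖ ^ 2 + q.2)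
    (h' : 0 < spaceNormSq q.1) : coneFn (moveToLevel q) = q.2 := by
  rw [coneFn_eq]
  congr 1
  simp only [moveToLevel, Fin.cons_zero, Fin.cons_succ, norm_mul, mul_pow, Complex.norm_real,
    Real.norm_eq_abs, sq_abs, Real.sq_sqrt (div_pos h h').le, ← Finset.mul_sum]
  rw [← spaceNormSq, div_mul_cancel₀ _ h'.ne']
  ring

theorem moveToLevel_self {ζ : Amb n} {t : ℝ} (h : coneFn ζ = t) (h' : 0 < spaceNormSq ζ) :
    moveToLevel (ζ, t) = ζ := by
  rw [coneFn_eq, Complex.ofReal_inj, ← spaceNormSq] at h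
  funext i
  refine Fin.cases rfl (fun j => ?_) i
  have : ‖ζ 0‖ ^ 2 + t = spaceNormSq ζ := by linarith
  simp [moveToLevel, this, div_self h'.ne']

/-- A smooth function vanishing on the null cone is divisible by its defining function. -/
theorem exists_eq_coneFn_mul {H : Amb n → ℂ} (z : Sph n)
    (hH : ∀ᶠ ζ in 𝓝 (homCoord 1 z), ContDiffAt ℝ ∞ H ζ)
    (h0 : ∀ᶠ ζ in 𝓝 (homCoord 1 z), coneFn ζ = 0 → H ζ = 0) :
    ∃ G : Amb n → ℂ, ContDiff ℝ ∞ G ∧ ∀ᶠ ζ in 𝓝 (homCoord 1 z), H ζ = coneFn ζ * G ζ := by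
  set p := homCoord 1 z with hp
  have hsp : spaceNormSq p = 1 := by
    simp only [spaceNormSq, hp, homCoord_one_succ, sum_norm_sq_coord]
  have h0p : ‖p 0‖ = 1 := by rw [hp, homCoord_one_zero, norm_one]
  have hcone : coneFn p = 0 := coneFn_homCoord_one z
  have hmp : moveToLevel (p, 0) = p :=
    moveToLevel_self (by rw [hcone, Complex.ofReal_zero]) (by rw [hsp]; exact one_pos)
  have hpos : ∀ᶠ q : Amb n × ℝ in 𝓝 (p, 0), 0 < ‖q.1 0‖ ^ 2 + q.2 ∧ 0 < spaceNormSq q.1 := by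
    have h1 : Continuous fun q : Amb n × ℝ => ‖q.1 0‖ ^ 2 + q.2 := by fun_prop
    have h2 : Continuous fun q : Amb n × ℝ => spaceNormSq q.1 :=
      contDiff_spaceNormSq.continuous.comp continuous_fst
    exact (h1.continuousAt.eventually_const_lt (by simp [h0p])).and
      (h2.continuousAt.eventually_const_lt (by simp [hsp]))
  have hmt : Filter.Tendsto (moveToLevel (n := n)) (𝓝 (p, 0)) (𝓝 p) := by
    have := (contDiffAt_moveToLevel hpos.self_of_nhds.1 hpos.self_of_nhds.2).continuousAt.tendsto
    rwa [hmp] at this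
  -- In the variables `(ζ, t)` the moved point lies on the cone exactly when `t = 0`, so Hadamard's
  -- lemma applies in `t`.
  obtain ⟨g, hg, hgf⟩ := exists_smooth_quotient_near (f := fun q => H (moveToLevel q))
    (q := (p, (0 : ℝ)))
    (by
      filter_upwards [hpos, hmt.eventually hH] with q hq h1
      exact ContDiffAt.comp q h1 (contDiffAt_moveToLevel hq.1 hq.2))
    (by
      filter_upwards [hpos, hmt.eventually h0] with q hq h1 h2
      exact h1 (by rw [coneFn_moveToLevel hq.1 hq.2, h2, Complex.ofReal_zero]))
  let r : Amb n → ℝ := fun ζ => -‖ζ 0‖ ^ 2 + spaceNormSq ζ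
  have hr : ContDiff ℝ ∞ r := (contDiff_coord_norm_sq 0).neg.add contDiff_spaceNormSq
  have hrc : ∀ ζ, coneFn ζ = r ζ := coneFn_eq
  have hrp : r p = 0 := by simp [r, hsp, h0p]
  have ht : Filter.Tendsto (fun ζ => (ζ, r ζ)) (𝓝 p) (𝓝 (p, 0)) := by
    have := (continuous_id.prodMk hr.continuous).tendsto p
    simpa [hrp] using this
  -- Substituting `t = r ζ` returns to `H`, since moving `ζ` to its own level does nothing.
  refine ⟨fun ζ => g (ζ, r ζ), hg.comp (contDiff_id.prodMk hr), ?_⟩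
  filter_upwards [ht.eventually hgf, ht.eventually hpos] with ζ h1 h2
  simp only [moveToLevel_self (hrc ζ) h2.2] at h1
  rw [h1, hrc, Complex.real_smul]

/-- `Δ^k F` on the null cone does not depend on the choice of the ambient extension `F`. -/
theorem ambLaplacian_iterate_eq_of_extension {k : ℕ} {w w' : ℂ} (hk : (k : ℂ) = w + w' + n + 1)
    {f : Sph n → ℂ} {z : Sph n} {F₁ F₂ : Amb n → ℂ} (h₁ : IsAmbientExtension w w' f z F₁)
    (h₂ : IsAmbientExtension w w' f z F₂) :
    (ambLaplacian^[k] F₁) (homCoord 1 z) = (ambLaplacian^[k] F₂) (homCoord 1 z) := by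
  have hneg : ∀ᶠ ζ in 𝓝 (homCoord 1 z), ContDiffAt ℝ ∞ (fun ζ => F₁ ζ + -1 * F₂ ζ) ζ := by
    filter_upwards [h₁.1, h₂.1] with ζ h1 h2
    exact h1.1.add (contDiffAt_const.mul h2.1)
  obtain ⟨G, hG, hHG⟩ := exists_eq_coneFn_mul z hneg (eventually_of_homCoord (by
    filter_upwards [h₁.2, h₂.2] with q h1 h2
    rw [h1, h2]
    ring))
  obtain ⟨U, hU, hUo, hzU⟩ := eventually_nhds_iff.1 ((h₁.1.and h₂.1).and hHG)
  have hs₁ : ContDiffOn ℝ ∞ F₁ U := fun ζ hζ => (hU ζ hζ).1.1.1.contDiffWithinAt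
  have hs₂ : ContDiffOn ℝ ∞ F₂ U := fun ζ hζ => (hU ζ hζ).1.2.1.contDiffWithinAt
  have he : ∀ c v : ℂ, Set.EqOn (euler c F₁) (fun η => v * F₁ η) U →
      Set.EqOn (euler c F₂) (fun η => v * F₂ η) U →
      Set.EqOn (euler c fun ζ => F₁ ζ + -1 * F₂ ζ) (fun η => v * (F₁ η + -1 * F₂ η)) U := by
    intro c v e1 e2 ζ hζ
    have e1 := e1 hζ
    have e2 := e2 hζ
    have d1 := differentiableAt_of_smoothOn hUo hs₁ hζ
    have d2 := differentiableAt_of_smoothOn hUo hs₂ hζ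
    simp only [euler, wirtinger_add d1 (d2.const_mul _), wirtinger_const_mul d2, mul_add,
      Finset.sum_add_distrib] at e1 e2 ⊢
    simp only [mul_left_comm _ (-1 : ℂ), ← Finset.mul_sum, e1, e2]
  have h := ambLaplacian_iterate_coneFn_mul_eq_zero hUo hG.contDiffOn (fun ζ hζ => (hU ζ hζ).2)
    (he (-1) w (fun ζ hζ => eulerZ_eq ▸ (hU ζ hζ).1.1.2.1)
      fun ζ hζ => eulerZ_eq ▸ (hU ζ hζ).1.2.2.1)
    (he 1 w' (fun ζ hζ => eulerZbar_eq ▸ (hU ζ hζ).1.1.2.2)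
      fun ζ hζ => eulerZbar_eq ▸ (hU ζ hζ).1.2.2.2) hk hzU (coneFn_homCoord_one z)
  rw [ambLaplacian_iterate_add hUo hs₁ (contDiffOn_const.mul hs₂) k hzU] at h
  beta_reduce at h
  rw [ambLaplacian_iterate_const_mul hUo hs₂ (-1) k hzU] at h
  linear_combination h

/-- Replaces the extension selected by choice with any convenient one. -/
theorem gjms_eq {k : ℕ} {w w' : ℂ} (hk : (k : ℂ) = w + w' + n + 1) {f : Sph n → ℂ} {z : Sph n}
    {F : Amb n → ℂ} (h : IsAmbientExtension w w' f z F) :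
    gjms n k w w' f z = (1 / 2 : ℂ) ^ k * (ambLaplacian^[k] F) (homCoord 1 z) := by
  have hex : ∃ F : Amb n → ℂ, IsAmbientExtension w w' f z F := ⟨F, h⟩
  rw [gjms, dif_pos hex, ambLaplacian_iterate_eq_of_extension hk hex.choose_spec h]
  simp [bipow]

end CRSphere

namespace CRSphere

variable {n : ℕ}

/-! ### Existence of ambient extensions -/

/-- The Euler fields combine the generators of real dilation and of rotation by phases, so bidegrees
can be read off from complex rescalings. -/
theorem euler_eq_fderiv {c : ℂ} (hc : c * c = 1) (F : Amb n → ℂ) (ζ : Amb n) :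
    euler c F ζ =
      (1 / 2) * (fderiv ℝ F ζ ζ + c * Complex.I * fderiv ℝ F ζ (Complex.I • ζ)) := by
  have h1 : ζ = ∑ i, ((ζ i).re • (Pi.single i 1 : Amb n) + (ζ i).im • (Pi.single i Complex.I : Amb n)) := by
    funext j
    rw [Finset.sum_apply, Finset.sum_eq_single j (fun i _ hi => by simp [hi.symm]) (by simp)]
    apply Complex.ext <;> simp
  have h2 : Complex.I • ζ =
      ∑ i, ((ζ i).re • (Pi.single i Complex.I : Amb n) - (ζ i).im • (Pi.single i 1 : Amb n)) := by
    funext j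
    rw [Finset.sum_apply, Finset.sum_eq_single j (fun i _ hi => by simp [hi.symm]) (by simp)]
    apply Complex.ext <;> simp
  generalize hA : fderiv ℝ F ζ = A
  have e1 : A ζ = ∑ i, ((ζ i).re * A (Pi.single i 1) + (ζ i).im * A (Pi.single i Complex.I)) := by
    conv_lhs => rw [h1]
    simp only [map_sum, map_add, map_smul, Complex.real_smul]
  have e2 : A (Complex.I • ζ) =
      ∑ i, ((ζ i).re * A (Pi.single i Complex.I) - (ζ i).im * A (Pi.single i 1)) := by
    rw [h2]
    simp only [map_sum, map_sub, map_smul, Complex.real_smul]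
  rw [e1, e2, Finset.mul_sum, ← Finset.sum_add_distrib, Finset.mul_sum]
  refine Finset.sum_congr rfl fun i _ => ?_
  simp only [ambCoord, wirtinger, hA]
  linear_combination (-(1 / 2) * (ζ i).im * A (Pi.single i Complex.I)) *
    (c * c * Complex.I_mul_I - hc)

theorem affineCoord_smul {a : ℂ} (ha : a ≠ 0) (ζ : Amb n) :
    affineCoord (a • ζ) = affineCoord ζ := by
  ext j
  simp [affineCoord, mul_div_mul_left _ _ ha]

/-- Along complex rescalings close to the identity, `z_0^w z̄_0^{w'}` is multiplicative. -/
theorem bipow_exp_mul (w w' c : ℂ) {a : ℂ} (ha : a ∈ Complex.slitPlane) :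
    ∀ᶠ t : ℝ in 𝓝 0, bipow w w' (Complex.exp (t * c) * a) =
      Complex.exp (t * (w * c + w' * conj c)) * bipow w w' a := by
  -- For small `t` the imaginary part stays in `(-π, π)`, so the logarithm of the product is the sum
  -- on the same branch.
  have hcont : Continuous fun t : ℝ => (t * c + Complex.log a).im := by fun_prop
  have h0 : ((0 : ℝ) * c + Complex.log a).im = a.arg := by simp [Complex.log_im]
  have hlt : a.arg < Real.pi :=
    lt_of_le_of_ne (Complex.arg_le_pi a) (Complex.mem_slitPlane_iff_arg.1 ha).1
  filter_upwards [hcont.continuousAt.eventually_const_lt (h0.symm ▸ Complex.neg_pi_lt_arg a),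
    hcont.continuousAt.eventually_lt_const (h0.symm ▸ hlt)] with t h1 h2
  have h3 : Complex.log (Complex.exp (t * c) * a) = t * c + Complex.log a := by
    rw [← Complex.log_exp h1 h2.le, Complex.exp_add,
      Complex.exp_log (Complex.slitPlane_ne_zero ha)]
  rw [bipow, h3, bipow, ← Complex.exp_add]
  congr 1
  simp only [map_add, map_mul, Complex.conj_ofReal]
  ring

theorem contDiffAt_bipow (w w' : ℂ) {a : ℂ} (ha : a ∈ Complex.slitPlane) :
    ContDiffAt ℝ ∞ (bipow w w') a := by
  have hl : ContDiffAt ℝ ∞ Complex.log a := 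
    ContDiffAt.restrict_scalars ℝ (𝕜' := ℂ) (Complex.contDiffAt_log ha)
  have hlc : ContDiffAt ℝ ∞ (fun a => conj (Complex.log a)) a :=
    Complex.conjCLE.contDiff.contDiffAt.comp a hl
  have he : ContDiff ℝ ∞ Complex.exp := 
    ContDiff.restrict_scalars ℝ (𝕜' := ℂ) Complex.contDiff_exp
  exact he.contDiffAt.comp a ((contDiffAt_const.mul hl).add (contDiffAt_const.mul hlc))

/-- Differentiate along `t ↦ e^(tc) ζ`: the affine coordinates are constant there and only the power
of `ζ_0` changes. -/
theorem fderiv_extension_apply_smul {w w' : ℂ} {v : EuclideanSpace ℂ (Fin (n + 1)) → ℂ} {ζ : Amb n}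
    (hζ : ζ 0 ∈ Complex.slitPlane)
    (hd : DifferentiableAt ℝ (fun η : Amb n => bipow w w' (η 0) * v (affineCoord η)) ζ) (c : ℂ) :
    fderiv ℝ (fun η : Amb n => bipow w w' (η 0) * v (affineCoord η)) ζ (c • ζ) =
      (w * c + w' * conj c) * (bipow w w' (ζ 0) * v (affineCoord ζ)) := by
  have hexp : ∀ b : ℂ, HasDerivAt (fun t : ℝ => Complex.exp (t * b)) b 0 := fun b => by
    have := (((hasDerivAt_id (0 : ℝ)).ofReal_comp).mul_const b).cexp
    simpa using this
  have hγ : HasDerivAt (fun t : ℝ => Complex.exp (t * c) • ζ) (c • ζ) 0 := (hexp c).smul_const ζ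
  have hγ0 : Complex.exp ((0 : ℝ) * c) • ζ = ζ := by simp
  have h1 := HasFDerivAt.comp_hasDerivAt (0 : ℝ) (hγ0.symm ▸ hd.hasFDerivAt) hγ
  rw [hγ0] at h1
  have h2 := (hexp (w * c + w' * conj c)).mul_const (bipow w w' (ζ 0) * v (affineCoord ζ))
  refine h1.unique (h2.congr_of_eventuallyEq ?_)
  filter_upwards [bipow_exp_mul w w' c hζ] with t ht
  simp only [Function.comp_apply, Pi.smul_apply, smul_eq_mul, ht,
    affineCoord_smul (Complex.exp_ne_zero _)]
  ring

/-- The ratios `ζ_j / ζ_0` have bidegree `(0, 0)`. Pulling `u` back through them and the radial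
projection gives bidegree zero, and a power of `ζ_0` carries the weight. -/
theorem exists_isAmbientExtension (w w' : ℂ) {u : Sph n → ℂ} (hu : SmoothOnSphere n u)
    (z : Sph n) : ∃ F : Amb n → ℂ, IsAmbientExtension w w' u z F := by
  refine ⟨fun η => bipow w w' (η 0) * u (sphProj z (affineCoord η)), ?_, ?_⟩
  · have hs : ∀ᶠ η : Amb n in 𝓝 (homCoord 1 z), η 0 ∈ Complex.slitPlane :=
      (continuous_apply 0).continuousAt.eventually_mem
        (Complex.isOpen_slitPlane.mem_nhds (by rw [homCoord_one_zero]; exact Complex.one_mem_slitPlane))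
    have hne : ∀ᶠ η : Amb n in 𝓝 (homCoord 1 z), affineCoord η ≠ 0 :=
      (contDiffAt_affineCoord (by rw [homCoord_one_zero]; exact one_ne_zero)).continuousAt.eventually_ne
        (by rw [affineCoord_homCoord one_ne_zero]; exact coe_ne_zero z)
    filter_upwards [hs, hne] with η h1 h2
    have hsm : ContDiffAt ℝ ∞
        (fun η : Amb n => bipow w w' (η 0) * u (sphProj z (affineCoord η))) η :=
      (ContDiffAt.comp η (f := fun η : Amb n => η 0) (contDiffAt_bipow w w' h1)
        (contDiff_apply ℝ ℂ 0).contDiffAt).mul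
        ((contDiffAt_comp_sphProj hu z h2).comp η
          (contDiffAt_affineCoord (Complex.slitPlane_ne_zero h1)))
    have hf := fderiv_extension_apply_smul (v := fun x => u (sphProj z x)) h1
      (hsm.differentiableAt (by simp))
    have hf1 := hf 1
    rw [one_smul] at hf1
    refine ⟨hsm, ?_, ?_⟩
    · rw [eulerZ_eq, euler_eq_fderiv (by norm_num), hf1, hf Complex.I]
      simp only [map_one, Complex.conj_I]
      linear_combination (-(1 / 2) * (w - w') * (bipow w w' (η 0) *
        u (sphProj z (affineCoord η)))) * Complex.I_mul_I
    · rw [eulerZbar_eq, euler_eq_fderiv (by norm_num), hf1, hf Complex.I]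
      simp only [map_one, Complex.conj_I]
      linear_combination ((1 / 2) * (w - w') * (bipow w w' (η 0) *
        u (sphProj z (affineCoord η)))) * Complex.I_mul_I
  · have : ∀ᶠ p : ℂ × Sph n in 𝓝 (1, z), p.1 ≠ 0 :=
      continuous_fst.continuousAt.eventually_ne one_ne_zero
    filter_upwards [this] with p hp
    rw [affineCoord_homCoord hp, sphProj_coe]
    rfl

/-- Multiplication by `ζ_i` raises the bidegree by `(1, 0)`. -/
theorem IsAmbientExtension.coord_mul {w w' : ℂ} {u f : Sph n → ℂ} {z : Sph n} {G : Amb n → ℂ}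
    (h : IsAmbientExtension (w - 1) w' u z G) (i : Fin (n + 2))
    (hf : ∀ (z₀ : ℂ) (y : Sph n), homCoord z₀ y i * u y = z₀ * f y) :
    IsAmbientExtension w w' f z fun ζ => ambCoord 1 i ζ * G ζ := by
  constructor
  · filter_upwards [h.1] with ζ hζ
    have hY := (contDiff_ambCoord (n := n) 1 i).contDiffAt (x := ζ)
    have d1 := hY.differentiableAt (by simp)
    have d2 := hζ.1.differentiableAt (by simp)
    have e1 := hζ.2.1
    have e2 := hζ.2.2
    rw [eulerZ_eq] at e1 ⊢
    rw [eulerZbar_eq] at e2 ⊢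
    refine ⟨hY.mul hζ.1, ?_, ?_⟩
    · rw [euler_mul d1 d2, e1, euler_ambCoord, neg_neg]
      ring
    · rw [euler_mul d1 d2, e2, euler_ambCoord]
      ring
  · have : ∀ᶠ p : ℂ × Sph n in 𝓝 (1, z), p.1 ≠ 0 :=
      continuous_fst.continuousAt.eventually_ne one_ne_zero
    filter_upwards [h.2, this] with p hp h0
    have hb : bipow w w' p.1 = bipow (w - 1) w' p.1 * p.1 := by
      conv_rhs => rw [← Complex.exp_log h0]
      rw [bipow, bipow, ← Complex.exp_add, Complex.exp_log h0]
      congr 1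
      ring
    rw [hp, ambCoord_one, hb]
    linear_combination bipow (w - 1) w' p.1 * hf p.1 p.2

end CRSphere

/-! ### The commutator identity -/

theorem theorem4p2 (n k : ℕ) (hk : 1 ≤ k) (w w' : ℂ) (hw : (k : ℂ) = w + w' + n + 1)
    (u : CRSphere.Sph n → ℂ) (hu : CRSphere.SmoothOnSphere n u) (z : CRSphere.Sph n) :
    ∑ j : Fin (n + 1), conj (CRSphere.coord j z) *
        CRSphere.commMul (CRSphere.gjms n k w w') (CRSphere.coord j) u z =
      -(k : ℂ) * (w' - k + 1) * CRSphere.gjms n (k - 1) (w - 1) w' u z := by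
  open CRSphere in
  obtain ⟨m, rfl⟩ : ∃ m, k = m + 1 := ⟨k - 1, by omega⟩
  obtain ⟨G, hG⟩ := exists_isAmbientExtension (w - 1) w' hu z
  obtain ⟨U, hU, hUo, hzU⟩ := eventually_nhds_iff.1 hG.1
  have hGs : ContDiffOn ℝ ∞ G U := fun ζ hζ => (hU ζ hζ).1.contDiffWithinAt
  -- The weight `(w - 1, w')` is critical for order `m = k - 1`, so `G` also computes the right-hand
  -- side.
  have hm : (m : ℂ) = w - 1 + w' + n + 1 := by push_cast at hw; linear_combination hw
  have hP0 : gjms n (m + 1) w w' u z = _ := gjms_eq hw (hG.coord_mul (f := u) 0 fun z₀ y => rfl)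
  have hPj : ∀ j : Fin (n + 1), gjms n (m + 1) w w' (fun y => coord j y * u y) z = _ := fun j =>
    gjms_eq hw (hG.coord_mul (f := fun y => coord j y * u y) j.succ fun z₀ y => by
      simp only [homCoord, Fin.cons_succ]; ring)
  -- The antiholomorphic Euler equation for `Δ^m G` at `(1, z)`, to be split into its `ζ̄_0` term
  -- and the rest.
  have hZ := euler_ambLaplacian_iterate hUo hGs (c := 1) (w := w') (by norm_num)
    (fun ζ hζ => eulerZbar_eq ▸ (hU ζ hζ).2.2) m hzU
  unfold euler at hZ
  rw [Fin.sum_univ_succ] at hZ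
  simp only [ambCoord_neg_one, homCoord_one_zero, homCoord_one_succ,
    map_one, one_mul] at hZ
  have hsum : ∑ j, conj (coord j z) * coord j z = 1 := by
    have := sum_norm_sq_coord z
    simp only [Complex.conj_mul']
    exact_mod_cast this
  have hit : ∀ i, _ := fun i => ambLaplacian_iterate_ambCoord_mul hUo hGs (c := 1)
    (by norm_num) i m hzU
  simp only [ambCoord_one] at hit hP0 hPj
  simp only [Nat.add_sub_cancel, gjms_eq hm hG, commMul, hP0, hPj, hit, signature, Fin.cons_zero,
    Fin.cons_succ, homCoord_one_zero, homCoord_one_succ]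
  set M := ambLaplacian^[m] G with hM
  -- The `Δ^(m+1) G` terms cancel, the sign `-1` at index `0` turns the difference into a sum, and
  -- the factor `2` absorbs one power of `1 / 2`.
  have hterm : ∀ j : Fin (n + 1), conj (coord j z) *
      ((1 / 2) ^ (m + 1) * (coord j z * ambLaplacian^[m + 1] G (homCoord 1 z) +
          (m + 1) * (-2 * 1) * wirtinger 1 j.succ M (homCoord 1 z)) -
        coord j z * ((1 / 2) ^ (m + 1) * (1 * ambLaplacian^[m + 1] G (homCoord 1 z) +
          (m + 1) * (-2 * -1) * wirtinger 1 0 M (homCoord 1 z)))) =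
      -(m + 1) * (1 / 2) ^ m * (conj (coord j z) * wirtinger 1 j.succ M (homCoord 1 z) +
        conj (coord j z) * coord j z * wirtinger 1 0 M (homCoord 1 z)) := fun j => by
    rw [pow_succ]
    ring
  rw [Finset.sum_congr rfl fun j _ => hterm j, ← Finset.mul_sum, Finset.sum_add_distrib,
    ← Finset.sum_mul, hsum]
  push_cast
  linear_combination (-(m + 1) * (1 / 2 : ℂ) ^ m) * hZ
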